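/- All graphs are finite and simple. For a graph $G$ and $S\subseteq V(G)$, let $c(G-S)$ denote the number of connected components of $G-S$; $S$ is a cut set of $G$ if $c(G-S)\ge 2$ (so $S=\emptyset$ is a cut set when $G$ is disconnected). For a real number $t\ge 0$, $G$ is $t$-tough if $t\cdot c(G-S)\le |S|$ for every cut set $S$ of $G$. Let $K_2\cup 3K_1$ be the disjoint union of an edge and three isolated vertices; $G$ is $(K_2\cup 3K_1)$-free if it has no induced subgraph isomorphic to $K_2\cup 3K_1$. $G$ is hamiltonian if it has a cycle containing every vertex of $G$. Theorem. If $G$ is a $3$-tough $(K_2\cup 3K_1)$-free graph on at least $3$ vertices, then $G$ is hamiltonian. -/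

import Mathlib

namespace SimpleGraph

/-- The number `c(G)` of connected components of `G`. -/
noncomputable def numComponents {V : Type*} (G : SimpleGraph V) : ℕ :=
  Nat.card G.ConnectedComponent

/-- `S` is a cut set of `G` if `G - S` is disconnected, i.e. has at least two components. -/
def IsCutSet {V : Type*} (G : SimpleGraph V) (S : Finset V) : Prop :=
  2 ≤ (G.induce (S : Set V)ᶜ).numComponents

/-- `G` is `t`-tough if `t * c(G - S) ≤ |S|` for every cut set `S` of `G`. -/
def IsTough {V : Type*} (G : SimpleGraph V) (t : ℝ) : Prop :=
  ∀ S : Finset V, G.IsCutSet S →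
    t * ((G.induce (S : Set V)ᶜ).numComponents : ℝ) ≤ (S.card : ℝ)

/-- `G` is `H`-free if no induced subgraph of `G` is isomorphic to `H`. -/
def IndFree {W V : Type*} (H : SimpleGraph W) (G : SimpleGraph V) : Prop :=
  ¬ H.IsIndContained G

/-- The graph `K₂ ∪ 3K₁`: the disjoint union of an edge and three isolated vertices. -/
def K2Union3K1 : SimpleGraph (Fin 2 ⊕ Fin 3) :=
  (⊤ : SimpleGraph (Fin 2)) ⊕g (⊥ : SimpleGraph (Fin 3))

end SimpleGraph

/-! Take a longest cycle and suppose a vertex `x` lies off it. A component of the rest has a set `W`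
of at least six neighbours on the cycle, by toughness, and by maximality their successors are
independent and miss the component. An edge in the component would give an induced K₂ ∪ 3K₁ with
three successors, so off-cycle vertices are independent (`mem_of_adj`).

Let `I` be `x` with the successors of `W`, and `J` the set of vertices without neighbours in `I`.
Freeness makes `J` independent and lets a vertex outside `J` miss at most two successors of `W`. Any
two vertices outside `J` thus share two of them as neighbours. Rerouting (`not_adj_of_two_off`,
`formPerm_crossing`) then puts every vertex outside `J` on the cycle, with its successor in `J`. So
`Jᶜ` is no larger than `J`, whereas toughness makes it at least three times as large. -/

namespace SimpleGraph

variable {V : Type*} {G : SimpleGraph V}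

/-! ### Walks and cycles as vertex lists -/

/-- `l` lists the vertices of a walk of `G` from `a` to `b`. -/
def IsSeg (G : SimpleGraph V) (a b : V) (l : List V) : Prop :=
  l.head? = some a ∧ l.getLast? = some b ∧ l.IsChain G.Adj

namespace IsSeg

variable {a b c d : V} {l m : List V}

theorem singleton (a : V) : G.IsSeg a a [a] := by simp [IsSeg]

theorem append (h : G.IsSeg a b l) (h' : G.IsSeg c d m) (hbc : G.Adj b c) :
    G.IsSeg a d (l ++ m) := by
  obtain ⟨h1, h2, h3⟩ := h
  obtain ⟨k1, k2, k3⟩ := h'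
  refine ⟨by simp [h1], by simp [k2], ?_⟩
  rw [List.isChain_append]
  refine ⟨h3, k3, ?_⟩
  simp [h2, k1, hbc]

theorem reverse (h : G.IsSeg a b l) : G.IsSeg b a l.reverse := by
  obtain ⟨h1, h2, h3⟩ := h
  refine ⟨by simp [h2], by simp [h1], ?_⟩
  rw [List.isChain_reverse]
  simpa [G.adj_comm] using h3

theorem ne_nil (h : G.IsSeg a b l) : l ≠ [] := by
  rintro rfl; simp [IsSeg] at h

theorem getLast_mem (h : G.IsSeg a b l) : b ∈ l := List.mem_of_getLast? h.2.1

theorem head_mem (h : G.IsSeg a b l) : a ∈ l := List.mem_of_head? h.1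

/-- A segment can be cut after any of its vertices other than the last one. -/
theorem exists_append_eq (h : G.IsSeg a b l) {w : V} (hw : w ∈ l) (hwb : w ≠ b) :
    ∃ c l₁ l₂, l = l₁ ++ l₂ ∧ G.IsSeg a w l₁ ∧ G.IsSeg c b l₂ := by
  obtain ⟨s, t, rfl⟩ := List.append_of_mem hw
  obtain ⟨h1, h2, h3⟩ := h
  cases t with
  | nil => simp at h2; exact absurd h2 hwb
  | cons c t =>
    rw [List.isChain_append_cons_cons] at h3
    refine ⟨c, s ++ [w], c :: t, by simp, ⟨?_, by simp, h3.1⟩, ⟨rfl, ?_, h3.2.2⟩⟩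
    · cases s <;> simpa using h1
    · simpa using h2

end IsSeg

/-- `l` lists the vertices of a cycle of `G`; single edges are allowed as cycles. -/
def IsCyclicList (G : SimpleGraph V) (l : List V) : Prop :=
  l.Nodup ∧ ∃ a b, G.IsSeg a b l ∧ G.Adj b a

/-- `l` lists the vertices of a cycle of `G` of maximum length. -/
def IsLongestCyclicList (G : SimpleGraph V) (l : List V) : Prop :=
  G.IsCyclicList l ∧ ∀ l', G.IsCyclicList l' → l'.length ≤ l.length

theorem exists_isLongestCyclicList [Fintype V] {a b : V} (hab : G.Adj a b) :
    ∃ l, G.IsLongestCyclicList l := by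
  classical
  have h0 : G.IsCyclicList [a, b] :=
    ⟨by simp [hab.ne], a, b, by simp [IsSeg, hab], hab.symm⟩
  have hb : ∀ n, (∃ l, G.IsCyclicList l ∧ l.length = n) → n ≤ Fintype.card V := by
    rintro n ⟨l, hl, rfl⟩
    exact hl.1.length_le_card
  obtain ⟨l, hl, hln⟩ := Nat.findGreatest_spec (P := fun n => ∃ l, G.IsCyclicList l ∧ l.length = n)
    (hb _ ⟨_, h0, rfl⟩) ⟨_, h0, rfl⟩
  refine ⟨l, hl, fun l' hl' => ?_⟩
  rw [hln]
  exact Nat.le_findGreatest (hb _ ⟨_, hl', rfl⟩) ⟨_, hl', rfl⟩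

theorem IsCyclicList.isHamiltonian [Fintype V] [DecidableEq V] {l : List V} (h : G.IsCyclicList l)
    (hcard : 3 ≤ Fintype.card V) (hl : ∀ v, v ∈ l) : G.IsHamiltonian := by
  intro _
  obtain ⟨hnd, a, b, ⟨h1, h2, h3⟩, hba⟩ := h
  have hlen : l.length = Fintype.card V := by
    rw [← List.toFinset_card_of_nodup hnd, ← Finset.card_univ]
    congr 1
    ext v
    simp [hl]
  obtain ⟨p, hp⟩ : ∃ p : G.Walk a b, p.support = l := by
    have hne : l ≠ [] := by rintro rfl; simp at h1
    have ha : l.head hne = a := by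
      rw [List.head?_eq_some_head hne] at h1; simpa using h1
    have hb : l.getLast hne = b := by
      rw [List.getLast?_eq_some_getLast hne] at h2; simpa using h2
    exact ⟨(Walk.ofSupport l hne h3).copy ha hb, by simp⟩
  have hpath : p.IsPath := by rw [Walk.isPath_def, hp]; exact hnd
  refine ⟨b, Walk.cons hba p, ?_⟩
  rw [Walk.isHamiltonianCycle_iff_isCycle_and_support_count_tail_eq_one, Walk.cons_isCycle_iff]
  refine ⟨⟨hpath, ?_⟩, fun v => ?_⟩
  · have hplen : p.length + 1 = l.length := by rw [← hp, Walk.length_support]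
    cases p with
    | nil => simp
    | cons hac q =>
      rw [Walk.cons_isPath_iff] at hpath
      rw [Walk.edges_cons, List.mem_cons, not_or]
      constructor
      -- A repeated edge would force a cycle of length two, excluded by `hcard`.
      · intro he
        rw [Sym2.eq_swap, Sym2.congr_right] at he
        subst he
        have := (Walk.isPath_iff_nil).mp hpath.1
        rw [Walk.length_cons, Walk.length_eq_zero_iff.mpr this] at hplen
        omega
      · intro he
        exact hpath.2 (Walk.snd_mem_support_of_mem_edges _ he)
  · simp only [Walk.support_cons, List.tail_cons, hp]
    exact List.count_eq_one_of_mem hnd (hl v)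

/-! ### Successors on a cycle and cutting it into segments -/

namespace IsCyclicList

variable [DecidableEq V] {l : List V}

/-- `formPerm` ignores rotation and sends the last entry of `t ++ s` to its first. It serves as the
successor map on the cycle. -/
theorem formPerm_of_append {s t : List V} (h : l.Nodup) (hr : l ~r s ++ t) {a b : V}
    (ha : s.getLast? = some a) (hb : t.head? = some b) : l.formPerm a = b := by
  have hr' : l ~r t ++ s := hr.trans List.isRotated_append
  rw [List.formPerm_eq_of_isRotated h hr']
  cases t with
  | nil => simp at hb
  | cons c t =>
    obtain rfl : c = b := by simpa using hb
    obtain ⟨s, rfl⟩ := List.getLast?_eq_some_iff.mp ha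
    have := List.formPerm_cons_concat_apply_last c a (t ++ s)
    simpa using this

theorem exists_isSeg (h : G.IsCyclicList l) {a : V} (ha : a ∈ l) :
    ∃ l', l ~r l' ∧ G.IsSeg (l.formPerm a) a l' := by
  obtain ⟨hnd, c, b, hs, hbc⟩ := h
  by_cases hab : a = b
  · subst hab
    have : l.formPerm a = c := by
      obtain ⟨h1, h2, -⟩ := hs
      cases l with
      | nil => simp at h1
      | cons d t =>
        obtain rfl : d = c := by simpa using h1
        have := List.formPerm_apply_getLast d t
        rw [List.getLast?_eq_some_getLast (by simp)] at h2
        rwa [Option.some_inj.mp h2] at this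
    rw [this]
    exact ⟨l, List.IsRotated.refl l, hs⟩
  · obtain ⟨d, l₁, l₂, rfl, h1, h2⟩ := hs.exists_append_eq ha hab
    rw [formPerm_of_append hnd (List.IsRotated.refl _) h1.2.1 h2.1]
    exact ⟨l₂ ++ l₁, List.isRotated_append, h2.append h1 hbc⟩

theorem exists_isSeg_append (h : G.IsCyclicList l) {a b : V} (ha : a ∈ l) (hb : b ∈ l)
    (hab : a ≠ b) :
    ∃ s t, l ~r s ++ t ∧ G.IsSeg (l.formPerm a) b s ∧ G.IsSeg (l.formPerm b) a t := by
  obtain ⟨l', hr, hs⟩ := h.exists_isSeg ha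
  obtain ⟨d, l₁, l₂, rfl, h1, h2⟩ := hs.exists_append_eq (hr.mem_iff.mp hb) hab.symm
  refine ⟨l₁, l₂, hr, h1, ?_⟩
  rwa [formPerm_of_append h.1 hr h1.2.1 h2.1]

/-- Three vertices cut a cycle into three segments, in one of the two cyclic orders. -/
theorem exists_isSeg_append_append (h : G.IsCyclicList l) {a b c : V} (ha : a ∈ l) (hb : b ∈ l)
    (hc : c ∈ l) (hab : a ≠ b) (hac : a ≠ c) (hbc : b ≠ c) :
    ∃ s t u, l ~r s ++ t ++ u ∧
      (G.IsSeg (l.formPerm a) b s ∧ G.IsSeg (l.formPerm b) c t ∧ G.IsSeg (l.formPerm c) a u ∨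
       G.IsSeg (l.formPerm a) c s ∧ G.IsSeg (l.formPerm c) b t ∧ G.IsSeg (l.formPerm b) a u) := by
  obtain ⟨s, t, hr, hs, ht⟩ := h.exists_isSeg_append ha hb hab
  have hc' := hr.mem_iff.mp hc
  rw [List.mem_append] at hc'
  rcases hc' with hc' | hc'
  · obtain ⟨d, l₁, l₂, rfl, h1, h2⟩ := hs.exists_append_eq hc' hbc.symm
    refine ⟨l₁, l₂, t, hr, Or.inr ⟨h1, ?_, ht⟩⟩
    rwa [formPerm_of_append (t := l₂ ++ t) (b := d) h.1 (by simpa using hr) h1.2.1 (by simp [h2.1])]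
  · obtain ⟨d, l₁, l₂, rfl, h1, h2⟩ := ht.exists_append_eq hc' hac.symm
    refine ⟨s, l₁, l₂, by simpa using hr, Or.inl ⟨hs, h1, ?_⟩⟩
    rwa [formPerm_of_append (s := s ++ l₁) h.1 (by simpa using hr) (by simp [h1.2.1]) h2.1]

end IsCyclicList

theorem Walk.isSeg_support {a b : V} (p : G.Walk a b) : G.IsSeg a b p.support :=
  ⟨by rw [List.head?_eq_some_head p.support_ne_nil, p.head_support],
    by rw [List.getLast?_eq_some_getLast p.support_ne_nil, p.getLast_support],
    p.isChain_adj_support⟩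

/-! ### Reroutings that would lengthen a longest cycle -/

theorem IsLongestCyclicList.not_adj_of_perm {l : List V} (h : G.IsLongestCyclicList l)
    {p l' : List V} {a b : V} (hp : p ≠ []) (hnd : p.Nodup) (hpl : ∀ v ∈ p, v ∉ l) (hs : G.IsSeg a b l') (hperm : l'.Perm (p ++ l)) :
    ¬ G.Adj b a := by
  intro hba
  have hnd' : l'.Nodup := by
    rw [hperm.nodup_iff, List.nodup_append']
    exact ⟨hnd, h.1.1, hpl⟩
  have h1 := h.2 l' ⟨hnd', a, b, hs, hba⟩
  rw [hperm.length_eq, List.length_append] at h1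
  have := List.length_pos_of_ne_nil hp
  omega

namespace IsLongestCyclicList

variable [DecidableEq V] {l : List V}

theorem formPerm_ne (h : G.IsLongestCyclicList l) {w w' x y : V} {p : List V} (hw : w ∈ l)
    (hp : G.IsSeg x y p) (hnd : p.Nodup) (hpl : ∀ v ∈ p, v ∉ l) (hwx : G.Adj w x)
    (hyw : G.Adj y w') : l.formPerm w ≠ w' := by
  rintro rfl
  obtain ⟨l', hr, hs⟩ := h.1.exists_isSeg hw
  exact h.not_adj_of_perm hp.ne_nil hnd hpl (hs.append hp hwx)
    (List.perm_append_comm.trans (hr.perm.symm.append_left p)) hyw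

theorem not_adj_formPerm (h : G.IsLongestCyclicList l) {w w' x y : V} {p : List V} (hw : w ∈ l)
    (hw' : w' ∈ l) (hne : w ≠ w') (hp : G.IsSeg x y p) (hnd : p.Nodup) (hpl : ∀ v ∈ p, v ∉ l)
    (hwx : G.Adj w x) (hyw : G.Adj y w') : ¬ G.Adj (l.formPerm w) (l.formPerm w') := by
  intro hadj
  obtain ⟨s, t, hr, hs, ht⟩ := h.1.exists_isSeg_append hw hw' hne
  -- Writing ⁺ for successor, the longer cycle is w⁺ … w', y … x, w … w'⁺, back to w⁺.
  refine h.not_adj_of_perm hp.ne_nil hnd hpl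
    ((hs.append hp.reverse hyw.symm).append ht.reverse hwx.symm) ?_ hadj.symm
  rw [List.perm_iff_count]
  intro v
  have := hr.perm.count_eq v
  simp only [List.count_append, List.count_reverse] at this ⊢
  omega

/-- Two vertices off a longest cycle cannot be inserted at the same time. -/
theorem not_adj_of_two_off (h : G.IsLongestCyclicList l) {w w' x y : V} (hw : w ∈ l)
    (hw' : w' ∈ l) (hne : w ≠ w') (hx : x ∉ l) (hy : y ∉ l) (hxy : x ≠ y) (hxw : G.Adj x w)
    (hxw' : G.Adj x w') (hyw : G.Adj y (l.formPerm w)) : ¬ G.Adj y (l.formPerm w') := by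
  intro hyw'
  obtain ⟨s, t, hr, hs, ht⟩ := h.1.exists_isSeg_append hw hw' hne
  -- The longer cycle is w' … w⁺, y, w'⁺ … w, x, back to w'.
  refine h.not_adj_of_perm (p := [x, y]) (by simp) (by simpa using hxy) (by simp [hx, hy])
    (((hs.reverse.append (.singleton y) hyw.symm).append ht hyw').append (.singleton x) hxw.symm)
    ?_ hxw'
  rw [List.perm_iff_count]
  intro v
  have := hr.perm.count_eq v
  simp only [List.count_append, List.count_reverse, List.count_cons, List.count_nil] at this ⊢
  omega

/-- If the cyclic order is v, w, w', the cycle w'⁺ … v, w⁺ … w', x, w … v⁺ is longer. The other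
order swaps w and w', hence the four adjacencies. -/
theorem formPerm_crossing (h : G.IsLongestCyclicList l) {v w w' x : V} (hv : v ∈ l) (hw : w ∈ l)
    (hw' : w' ∈ l) (hvw : v ≠ w) (hvw' : v ≠ w') (hne : w ≠ w') (hx : x ∉ l) (hxw : G.Adj x w)
    (hxw' : G.Adj x w') (h1 : G.Adj v (l.formPerm w)) (h2 : G.Adj v (l.formPerm w'))
    (h3 : G.Adj (l.formPerm v) (l.formPerm w)) (h4 : G.Adj (l.formPerm v) (l.formPerm w')) :
    False := by
  obtain ⟨s, t, u, hr, ⟨hs, ht, hu⟩ | ⟨hs, ht, hu⟩⟩ :=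
    h.1.exists_isSeg_append_append hv hw hw' hvw hvw' hne
  · refine h.not_adj_of_perm (p := [x]) (by simp) (by simp) (by simp [hx])
      (((hu.append ht h1).append (.singleton x) hxw'.symm).append hs.reverse hxw) ?_ h4
    rw [List.perm_iff_count]
    intro v
    have := hr.perm.count_eq v
    simp only [List.count_append, List.count_reverse] at this ⊢
    omega
  · refine h.not_adj_of_perm (p := [x]) (by simp) (by simp) (by simp [hx])
      (((hu.append ht h2).append (.singleton x) hxw.symm).append hs.reverse hxw') ?_ h3
    rw [List.perm_iff_count]
    intro v
    have := hr.perm.count_eq v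
    simp only [List.count_append, List.count_reverse] at this ⊢
    omega

end IsLongestCyclicList

/-! ### Consequences of toughness and of the forbidden subgraph -/

theorem IsTough.six_le_card [Fintype V] (h : G.IsTough 3) {S : Finset V} {X : Set V} {x y : V}
    (hx : x ∈ X) (hy : y ∉ X) (hxS : x ∉ S) (hyS : y ∉ S)
    (hX : ∀ u ∈ X, ∀ v, v ∉ S → G.Adj u v → v ∈ X) : 6 ≤ S.card := by
  have hreach : ∀ u v, (G.induce (S : Set V)ᶜ).Reachable u v → u.1 ∈ X → v.1 ∈ X := by
    rintro u v ⟨p⟩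
    induction p with
    | nil => exact id
    | @cons a b c hab _ ih => exact fun ha => ih (hX _ ha _ b.2 hab)
  have hcut : G.IsCutSet S := by
    unfold IsCutSet numComponents
    have : Nontrivial (G.induce (S : Set V)ᶜ).ConnectedComponent := by
      refine ⟨connectedComponentMk _ ⟨x, by simpa using hxS⟩,
        connectedComponentMk _ ⟨y, by simpa using hyS⟩, fun he => hy ?_⟩
      exact hreach _ _ (ConnectedComponent.exact he) hx
    exact Finite.one_lt_card
  have h1 := h S hcut
  have h2 : (2 : ℝ) ≤ ((G.induce (S : Set V)ᶜ).numComponents : ℝ) := by exact_mod_cast hcut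
  have h3 : (6 : ℝ) ≤ (S.card : ℝ) := by linarith
  exact_mod_cast h3

/-- Deleting `Jᶜ` leaves each vertex of `J` as a component. -/
theorem IsTough.three_mul_card_le [Fintype V] [DecidableEq V] (h : G.IsTough 3) {J : Finset V}
    (hJ : ∀ u ∈ J, ∀ v ∈ J, ¬ G.Adj u v) (h2 : 2 ≤ J.card) : 3 * J.card ≤ Jᶜ.card := by
  have hle : J.card ≤ (G.induce ((Jᶜ : Finset V) : Set V)ᶜ).numComponents := by
    unfold numComponents
    have hmem : ∀ v ∈ J, v ∈ ((Jᶜ : Finset V) : Set V)ᶜ := by simp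
    have hinj : Function.Injective fun j : J =>
        connectedComponentMk (G.induce ((Jᶜ : Finset V) : Set V)ᶜ) ⟨j.1, hmem _ j.2⟩ := by
      have hwalk : ∀ u v, (G.induce ((Jᶜ : Finset V) : Set V)ᶜ).Walk u v → u = v := by
        intro u v p
        cases p with
        | nil => rfl
        | @cons _ b _ hab _ => exact absurd hab (hJ _ (by simpa using u.2) _ (by simpa using b.2))
      intro j k hjk
      obtain ⟨p⟩ := ConnectedComponent.exact hjk
      exact Subtype.ext (Subtype.mk.inj (hwalk _ _ p))
    simpa using Nat.card_le_card_of_injective _ hinj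
  have h1 := h Jᶜ (h2.trans hle)
  have h3 : (3 : ℝ) * (J.card : ℝ) ≤ (Jᶜ.card : ℝ) := by
    refine le_trans ?_ h1
    gcongr
  exact_mod_cast h3

theorem IsTough.exists_adj [Fintype V] [Nontrivial V] (h : G.IsTough 3) : ∃ a b, G.Adj a b := by
  by_contra! hno
  obtain ⟨a, b, hab⟩ := exists_pair_ne V
  have := h.six_le_card (S := ∅) (X := {a}) (x := a) (y := b) rfl hab.symm (by simp) (by simp)
    (fun u _ v _ huv => absurd huv (hno u v))
  simp at this

/-- In a `(K₂ ∪ 3K₁)`-free graph at most two vertices of an independent set miss both ends of a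
given edge. -/
theorem IndFree.card_le_two [DecidableEq V] (h : K2Union3K1.IndFree G) {u v : V}
    (huv : G.Adj u v) {T : Finset V} (hT : ∀ a ∈ T, ∀ b ∈ T, ¬ G.Adj a b)
    (hu : ∀ a ∈ T, ¬ G.Adj u a) (hv : ∀ a ∈ T, ¬ G.Adj v a) : T.card ≤ 2 := by
  by_contra! hc
  obtain ⟨f, hf⟩ : ∃ f : Fin 3 ↪ V, ∀ i, f i ∈ T := by
    obtain ⟨T', hT', hc'⟩ := Finset.exists_subset_card_eq hc
    exact ⟨(T'.equivFinOfCardEq hc').symm.toEmbedding.trans (.subtype _),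
      fun i => hT' (Subtype.property _)⟩
  have huT : ∀ i, u ≠ f i := fun i he => hv _ (hf i) (he ▸ huv.symm)
  have hvT : ∀ i, v ≠ f i := fun i he => hu _ (hf i) (he ▸ huv)
  refine h ⟨⟨⟨Sum.elim ![u, v] f, ?_⟩, ?_⟩⟩
  · refine Function.Injective.sumElim ?_ f.injective ?_
    · intro i j
      fin_cases i <;> fin_cases j <;> simp [huv.ne, huv.ne']
    · intro i j
      fin_cases i <;> simp [huT, hvT]
  · rintro (i | i) (j | j)
    · fin_cases i <;> fin_cases j <;> simp [K2Union3K1, huv, huv.symm]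
    · fin_cases i <;> simp [K2Union3K1, hu _ (hf j), hv _ (hf j)]
    · fin_cases j <;> simp [K2Union3K1, G.adj_comm (f i), hu _ (hf i), hv _ (hf i)]
    · simp [K2Union3K1, hT _ (hf i) _ (hf j)]

/-! ### Vertices off a longest cycle -/

/-- The neighbours on a longest cycle of a connected piece `X` of the rest of the graph. -/
theorem IsLongestCyclicList.attachments [Fintype V] [DecidableEq V] {l : List V}
    (h : G.IsLongestCyclicList l) (htough : G.IsTough 3) {X : Set V} {x : V} (hx : x ∈ X)
    (hXl : ∀ y ∈ X, y ∉ l)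
    (hconn : ∀ y ∈ X, ∀ z ∈ X, ∃ p, G.IsSeg y z p ∧ p.Nodup ∧ ∀ v ∈ p, v ∈ X)
    (hclosed : ∀ y ∈ X, ∀ z, z ∉ l → G.Adj y z → z ∈ X)
    {W : Finset V} (hW : ∀ w, w ∈ W ↔ w ∈ l ∧ ∃ y ∈ X, G.Adj y w) :
    6 ≤ W.card ∧ (∀ w ∈ W, l.formPerm w ∉ W) ∧
      ∀ w ∈ W, ∀ w' ∈ W, ¬ G.Adj (l.formPerm w) (l.formPerm w') := by
  have hdisj : ∀ w ∈ W, l.formPerm w ∉ W := by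
    intro w hw hw'
    obtain ⟨hwl, y, hy, hyw⟩ := (hW _).mp hw
    obtain ⟨-, z, hz, hzw⟩ := (hW _).mp hw'
    obtain ⟨p, hp, hnd, hpX⟩ := hconn y hy z hz
    exact h.formPerm_ne hwl hp hnd (fun v hv => hXl v (hpX v hv)) hyw.symm hzw rfl
  refine ⟨?_, hdisj, ?_⟩
  -- `W` separates `X` from any cycle vertex `c` outside `W`.
  · obtain ⟨c, hc, hcW⟩ : ∃ c ∈ l, c ∉ W := by
      obtain ⟨-, a, b, hs, -⟩ := h.1
      by_cases ha : a ∈ W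
      · exact ⟨_, List.formPerm_apply_mem_of_mem hs.head_mem, hdisj a ha⟩
      · exact ⟨a, hs.head_mem, ha⟩
    refine htough.six_le_card hx (fun hcX => hXl c hcX hc) (fun hxW => hXl x hx ((hW x).mp hxW).1)
      hcW fun u hu v hv huv => ?_
    by_cases hvl : v ∈ l
    · exact absurd ((hW v).mpr ⟨hvl, u, hu, huv⟩) hv
    · exact hclosed u hu v hvl huv
  · intro w hw w' hw'
    rcases eq_or_ne w w' with rfl | hne
    · exact G.irrefl
    obtain ⟨hwl, y, hy, hyw⟩ := (hW _).mp hw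
    obtain ⟨hwl', z, hz, hzw⟩ := (hW _).mp hw'
    obtain ⟨p, hp, hnd, hpX⟩ := hconn y hy z hz
    exact h.not_adj_formPerm hwl hwl' hne hp hnd (fun v hv => hXl v (hpX v hv)) hyw.symm hzw

/-- The vertices off a longest cycle are independent. -/
theorem IsLongestCyclicList.mem_of_adj [Fintype V] [DecidableEq V] {l : List V}
    (h : G.IsLongestCyclicList l) (htough : G.IsTough 3) (hfree : K2Union3K1.IndFree G)
    {x z : V} (hx : x ∉ l) (hxz : G.Adj x z) : z ∈ l := by
  classical
  by_contra hz
  let H := G.induce {v | v ∉ l}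
  let X : Set V := {y | ∃ hy : y ∉ l, H.Reachable ⟨x, hx⟩ ⟨y, hy⟩}
  have hxX : x ∈ X := ⟨hx, Reachable.refl _⟩
  have hclosed : ∀ y ∈ X, ∀ z, z ∉ l → G.Adj y z → z ∈ X := by
    rintro y ⟨hy, hr⟩ z hz hyz
    have hyz' : H.Adj ⟨y, hy⟩ ⟨z, hz⟩ := hyz
    exact ⟨hz, hr.trans hyz'.reachable⟩
  have hconn : ∀ y ∈ X, ∀ z ∈ X, ∃ p, G.IsSeg y z p ∧ p.Nodup ∧ ∀ v ∈ p, v ∈ X := by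
    rintro y ⟨hy, hry⟩ z ⟨hz, hrz⟩
    obtain ⟨p, hp⟩ := (hry.symm.trans hrz).exists_isPath
    refine ⟨_, (p.map (Embedding.induce _).toHom).isSeg_support, ?_, ?_⟩
    · exact (hp.map Subtype.val_injective).support_nodup
    · intro v hv
      rw [Walk.support_map, List.mem_map] at hv
      obtain ⟨u, hu, rfl⟩ := hv
      exact ⟨u.2, hry.trans ⟨p.takeUntil u hu⟩⟩
  have hXl : ∀ y ∈ X, y ∉ l := fun y hy => hy.1
  let W : Finset V := {w | w ∈ l ∧ ∃ y ∈ X, G.Adj y w}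
  have hW : ∀ w, w ∈ W ↔ w ∈ l ∧ ∃ y ∈ X, G.Adj y w := by simp [W]
  obtain ⟨h6, hdisj, hind⟩ := h.attachments htough hxX hXl hconn hclosed hW
  have hmiss : ∀ y ∈ X, ∀ a ∈ W.image l.formPerm, ¬ G.Adj y a := by
    intro y hy a ha hya
    obtain ⟨w, hw, rfl⟩ := Finset.mem_image.mp ha
    exact hdisj w hw ((hW _).mpr
      ⟨List.formPerm_apply_mem_of_mem ((hW w).mp hw).1, y, hy, hya⟩)
  have := hfree.card_le_two hxz (T := W.image l.formPerm)
    (by simpa [Finset.forall_mem_image] using hind) (hmiss x hxX)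
    (hmiss z (hclosed x hxX z hz hxz))
  rw [Finset.card_image_of_injective _ (Equiv.injective _)] at this
  omega

theorem IsLongestCyclicList.mem [Fintype V] [DecidableEq V] {l : List V}
    (h : G.IsLongestCyclicList l) (htough : G.IsTough 3) (hfree : K2Union3K1.IndFree G)
    (x : V) : x ∈ l := by
  classical
  by_contra hx
  have hnbr : ∀ z, G.Adj x z → z ∈ l := fun z => h.mem_of_adj htough hfree hx
  let W : Finset V := {w | G.Adj x w}
  have hW : ∀ w, w ∈ W ↔ G.Adj x w := by simp [W]
  obtain ⟨h6, hdisj, hind⟩ := h.attachments (X := {x}) (W := W) htough rfl (by simpa using hx)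
    (by simpa using ⟨[x], IsSeg.singleton x, by simp⟩)
    (by simpa using fun z hz hxz => absurd (hnbr z hxz) hz) (by simpa [hW] using hnbr)
  let σ := l.formPerm
  let I : Finset V := insert x (W.image σ)
  have hσI : ∀ w ∈ W, σ w ∈ I := fun w hw =>
    Finset.mem_insert_of_mem (Finset.mem_image_of_mem _ hw)
  have hxσ : ∀ w ∈ W, ¬ G.Adj x (σ w) := fun w hw hadj => hdisj w hw ((hW _).mpr hadj)
  have hI : ∀ a ∈ I, ∀ b ∈ I, ¬ G.Adj a b := by
    simp only [I, Finset.forall_mem_insert, Finset.forall_mem_image]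
    refine ⟨⟨G.irrefl, hxσ⟩, fun w hw => ⟨fun hadj => hxσ w hw hadj.symm, hind w hw⟩⟩
  have hIcard : 6 ≤ I.card := by
    refine h6.trans ?_
    rw [← Finset.card_image_of_injective W σ.injective]
    exact Finset.card_le_card (Finset.subset_insert _ _)
  let J : Finset V := {v | ∀ i ∈ I, ¬ G.Adj v i}
  have hJ : ∀ v, v ∈ J ↔ ∀ i ∈ I, ¬ G.Adj v i := by simp [J]
  have hIJ : I ⊆ J := fun i hi => (hJ i).mpr (hI i hi)
  have hJind : ∀ u ∈ J, ∀ v ∈ J, ¬ G.Adj u v := by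
    intro u hu v hv huv
    have := hfree.card_le_two huv hI ((hJ u).mp hu) ((hJ v).mp hv)
    omega
  -- Freeness is applied to an edge from `v` to a vertex of `I`.
  have hmiss : ∀ v, v ∉ J → (W.filter fun w => ¬ G.Adj v (σ w)).card ≤ 2 := by
    intro v hv
    obtain ⟨i, hi, hvi⟩ : ∃ i ∈ I, G.Adj v i := by simpa [hJ] using hv
    rw [← Finset.card_image_of_injective _ σ.injective]
    have hsub : ∀ a ∈ (W.filter fun w => ¬ G.Adj v (σ w)).image σ, a ∈ I ∧ ¬ G.Adj v a := by
      simp only [Finset.forall_mem_image, Finset.mem_filter]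
      exact fun w hw => ⟨hσI w hw.1, hw.2⟩
    exact hfree.card_le_two hvi (fun a ha b hb => hI a (hsub a ha).1 b (hsub b hb).1)
      (fun a ha => (hsub a ha).2) (fun a ha => hI i hi a (hsub a ha).1)
  -- At least 6 − 2 − 2 successors are common neighbours.
  have hcommon : ∀ u v, u ∉ J → v ∉ J → ∃ w ∈ W, ∃ w' ∈ W, w ≠ w' ∧
      (G.Adj u (σ w) ∧ G.Adj v (σ w)) ∧ G.Adj u (σ w') ∧ G.Adj v (σ w') := by
    intro u v hu hv
    have h1 := hmiss u hu
    have h2 := hmiss v hv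
    have h3 : W ⊆ (W.filter fun w => G.Adj u (σ w) ∧ G.Adj v (σ w)) ∪
        ((W.filter fun w => ¬ G.Adj u (σ w)) ∪ W.filter fun w => ¬ G.Adj v (σ w)) := by
      intro w hw
      simp only [Finset.mem_union, Finset.mem_filter]
      tauto
    have h4 := (Finset.card_le_card h3).trans (Finset.card_union_le _ _)
    have h5 := Finset.card_union_le (W.filter fun w => ¬ G.Adj u (σ w))
      (W.filter fun w => ¬ G.Adj v (σ w))
    obtain ⟨w, hw, w', hw', hne⟩ := Finset.one_lt_card.mp
      (show 1 < (W.filter fun w => G.Adj u (σ w) ∧ G.Adj v (σ w)).card by omega)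
    rw [Finset.mem_filter] at hw hw'
    exact ⟨w, hw.1, w', hw'.1, hne, hw.2, hw'.2⟩
  have hWl : ∀ w ∈ W, w ∈ l := fun w hw => hnbr w ((hW w).mp hw)
  have hJl : ∀ v, v ∉ J → v ∈ l := by
    intro v hv
    by_contra hvl
    obtain ⟨w, hw, w', hw', hne, ⟨h1, -⟩, h2, -⟩ := hcommon v v hv hv
    have hxv : x ≠ v := by
      rintro rfl
      exact hv (hIJ (Finset.mem_insert_self _ _))
    exact h.not_adj_of_two_off (hWl w hw) (hWl w' hw') hne hx hvl hxv ((hW w).mp hw)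
      ((hW w').mp hw') h1 h2
  have hσJ : ∀ v, v ∉ J → σ v ∈ J := by
    intro v hv
    by_contra hσv
    -- Successors of `W` lie in `J`, so `v` is not in `W`, as the crossing requires.
    have hvW : ∀ w ∈ W, v ≠ w := by
      rintro w hw rfl
      exact hσv (hIJ (hσI v hw))
    obtain ⟨w, hw, w', hw', hne, ⟨h1, h3⟩, h2, h4⟩ := hcommon v (σ v) hv hσv
    exact h.formPerm_crossing (hJl v hv) (hWl w hw) (hWl w' hw') (hvW w hw) (hvW w' hw') hne hx
      ((hW w).mp hw) ((hW w').mp hw') h1 h2 h3 h4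
  have hJcard : 6 ≤ J.card := hIcard.trans (Finset.card_le_card hIJ)
  have hle : Jᶜ.card ≤ J.card :=
    Finset.card_le_card_of_injOn σ (fun v hv => hσJ v (by simpa using hv)) σ.injective.injOn
  have := htough.three_mul_card_le hJind (by omega)
  omega

end SimpleGraph

theorem theorem1 {V : Type*} [Fintype V] [DecidableEq V] (G : SimpleGraph V)
    (hcard : 3 ≤ Fintype.card V) (htough : G.IsTough 3)
    (hfree : SimpleGraph.K2Union3K1.IndFree G) : G.IsHamiltonian := by
  have : Nontrivial V := Fintype.one_lt_card_iff_nontrivial.mp (by omega)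
  obtain ⟨a, b, hab⟩ := htough.exists_adj
  obtain ⟨l, hl⟩ := SimpleGraph.exists_isLongestCyclicList hab
  exact hl.1.isHamiltonian hcard (hl.mem htough hfree)
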